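/- A rooted one-face map with $n$ edges is encoded by a triple $(\alpha,\beta,\gamma)$ of permutations of the set $[2n]=\{1,\dots,2n\}$ of half-edges, where $\alpha$ is an involution without fixed points (its cycles are the edges), the cycles of $\beta$ (fixed points included) are the vertices, and $\gamma=\alpha\beta$ (first apply $\beta$, then $\alpha$) is a single cycle through all of $[2n]$; the half-edge $1$ is the root. Two such triples $(\alpha,\beta,\gamma)$ and $(\alpha',\beta',\gamma')$ are equivalent if there is a permutation $\pi$ of $[2n]$ with $\alpha'=\pi\alpha\pi^{-1}$, $\gamma'=\pi\gamma\pi^{-1}$ and $\pi(1)=1$. The genus $g$ is defined by $v-n+1=2-2g$, where $v$ is the number of vertices; for $n=0$ there is exactly one map, consisting of a single vertex ($v=1$). Let $A(n,g)$ be the number of equivalence classes of rooted one-face maps with $n$ edges and genus $g$. Then for all integers $n\ge 0$ and $g\ge 0$, $$2g\,A(n,g)=\sum_{k=1}^{g}\binom{n+1-2(g-k)}{2k+1}A(n,g-k).$$ -/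

import Mathlib

/-- A labelled rooted one-face map with `n` edges, on a closed orientable surface, encoded as a
fatgraph: `Fin (2 * n)` is the set of half-edges, the half-edge with label `0` is the root,
the cycles of `α` are the edges, the cycles of `β` are the vertices with the cyclic order of their
half-edges, and `γ = αβ` (first `β`, then `α`), which describes the boundary, consists of a single
cycle through all half-edges. -/
@[ext]
structure RootedOneFaceMap (n : ℕ) where
  α : Equiv.Perm (Fin (2 * n))
  β : Equiv.Perm (Fin (2 * n))
  γ : Equiv.Perm (Fin (2 * n))
  involutive : ∀ i, α (α i) = i
  fixedPointFree : ∀ i, α i ≠ i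
  γ_eq : γ = α * β
  oneFace : γ.IsCycleOn Set.univ

namespace RootedOneFaceMap

/-- The number of vertices: the number of cycles of `β`, fixed points included. The map without
edges consists of one vertex, which carries no half-edge. -/
noncomputable def numVertices {n : ℕ} (M : RootedOneFaceMap n) : ℕ :=
  if n = 0 then 1 else Nat.card (Quotient (Equiv.Perm.SameCycle.setoid M.β))

/-- `M` has genus `g`, by Euler's characteristic formula `v - n + 1 = 2 - 2g`. -/
def HasGenus {n : ℕ} (M : RootedOneFaceMap n) (g : ℕ) : Prop :=
  (M.numVertices : ℤ) - n + 1 = 2 - 2 * g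

/-- Equivalence of rooted maps: a relabelling `π` of the half-edges that fixes the root, and carries
`α` to `α'` and `γ` to `γ'` by conjugation. -/
def Equivalent {n : ℕ} (M M' : RootedOneFaceMap n) : Prop :=
  ∃ π : Equiv.Perm (Fin (2 * n)),
    M'.α = π * M.α * π⁻¹ ∧ M'.γ = π * M.γ * π⁻¹ ∧ ∀ i, i.val = 0 → π i = i

theorem equivalent_equivalence (n : ℕ) :
    Equivalence (Equivalent : RootedOneFaceMap n → RootedOneFaceMap n → Prop) where
  refl M := ⟨1, by simp, by simp, by simp⟩
  symm := by
    rintro M M' ⟨π, hα, hγ, h⟩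
    refine ⟨π⁻¹, by rw [hα]; group, by rw [hγ]; group, fun i hi => ?_⟩
    rw [Equiv.Perm.inv_eq_iff_eq, h i hi]
  trans := by
    rintro M M' M'' ⟨π, hα, hγ, h⟩ ⟨ρ, hα', hγ', h'⟩
    refine ⟨ρ * π, by rw [hα', hα]; group, by rw [hγ', hγ]; group, fun i hi => ?_⟩
    rw [Equiv.Perm.mul_apply, h i hi, h' i hi]

/-- Equivalence of rooted maps as a setoid. -/
def equivSetoid (n : ℕ) : Setoid (RootedOneFaceMap n) :=
  ⟨Equivalent, equivalent_equivalence n⟩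

end RootedOneFaceMap

/-- `A(n, g)`: the number of equivalence classes of rooted one-face maps of genus `g` with `n`
edges. -/
noncomputable def oneFaceMapCount (n g : ℕ) : ℕ :=
  Nat.card (Quotient ((RootedOneFaceMap.equivSetoid n).comap
    (Subtype.val : {M : RootedOneFaceMap n // M.HasGenus g} → RootedOneFaceMap n)))

/-! Fix the edge involution `α` on the `2n` half-edges, `n ≥ 1`, and let `P(N)` be the sum of `N ^
(number of vertices)` over all long cycles `γ`; the vertices are the cycles of `α⁻¹γ`, so `P(N)`
counts vertex colourings by `N` colours. The theorem is the coefficient form of `2(n+1) P(x) = x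
(P(x+1) - P(x-1))`: the coefficient of `x^v` with `v = n+1-2g` gives the recurrence once its `k = 0`
term is moved to the left.

To compute `P`, the indicator of the long cycles is written as `∑ (-1)^|S| sign(γ|S)` over the
`γ`-stable sets `S` avoiding a fixed half-edge `r` (`sum_neg_one_pow_card_mul_signOn`). For fixed
`S`, the sum over `γ` depends on how `S` meets the edges. If `S` is a union of edges, it is a signed
product of a falling and a rising factorial. If one edge is split, a transposition joining two
cycles costs a factor `N`. If two half-edges are unpaired, a sign-reversing substitution gives zero.
Summing over `S` turns `P` into iterated differences of `(x+1)⋯(x+2m+1)`, `m = n-1`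
(`sum_isCycleOn_invariantColorings`), and the relation for `P` follows from linear recurrences among
these (`oneFaceSum_relation`).

Rooted maps have no nontrivial automorphisms, so `A(n,g)` is proportional to the coefficient of `P`
with a factor independent of `g`, which cancels. -/

open Equiv

/-! ### Colourings invariant under a permutation -/

/-- The number of colourings of `X` by `K` that are constant on the cycles of `ρ`. -/
noncomputable def invariantColorings (K : Type*) {X : Type*} (ρ : Perm X) : ℕ :=
  Nat.card {c : X → K // ∀ x, c (ρ x) = c x}

section Colorings

variable {X Y K : Type*}

theorem invariant_zpow {c : X → K} {ρ : Perm X} (h : ∀ x, c (ρ x) = c x) (k : ℤ) (x : X) :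
    c ((ρ ^ k) x) = c x := by
  induction k using Int.induction_on with
  | zero => simp
  | succ i ih => rw [add_comm, zpow_add, zpow_one, Perm.mul_apply, h, ih]
  | pred i ih =>
    rw [← ih, ← h ((ρ ^ (-(i : ℤ) - 1)) x), ← Perm.mul_apply, ← zpow_one_add,
      add_sub_cancel]

theorem invariantColorings_eq_pow [Finite X] [Finite K] (ρ : Perm X) :
    invariantColorings K ρ = Nat.card K ^ Nat.card (Quotient (Perm.SameCycle.setoid ρ)) := by
  rw [← Nat.card_fun]
  refine Nat.card_congr ⟨fun c q => Quotient.lift c.1 ?_ q, fun d => ⟨fun x => d ⟦x⟧, ?_⟩, ?_, ?_⟩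
  · rintro a _ ⟨k, rfl⟩
    exact (invariant_zpow c.2 k a).symm
  · intro x
    exact congrArg d (Quotient.sound ⟨-1, by simp⟩)
  · intro c
    rfl
  · intro d
    funext q
    induction q using Quotient.inductionOn with
    | h x => rfl

theorem invariantColorings_congr (K : Type*) (e : X ≃ Y) (ρ : Perm X) (ρ' : Perm Y)
    (h : ∀ x, e (ρ x) = ρ' (e x)) :
    invariantColorings K ρ = invariantColorings K ρ' := by
  refine Nat.card_congr ((e.arrowCongr (Equiv.refl K)).subtypeEquiv fun c => ?_)
  constructor
  · intro hc y
    obtain ⟨x, rfl⟩ := e.surjective y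
    simp [← h, hc]
  · intro hc x
    simpa [← h] using hc (e x)

theorem invariantColorings_conj (K : Type*) (s ρ : Perm X) :
    invariantColorings K (s * ρ * s⁻¹) = invariantColorings K ρ :=
  (invariantColorings_congr K s ρ _ (by simp)).symm

theorem invariantColorings_decomposeOption_none [DecidableEq X] (ρ : Perm X) :
    invariantColorings K (Perm.decomposeOption.symm (none, ρ)) =
      Nat.card K * invariantColorings K ρ := by
  unfold invariantColorings
  rw [← Nat.card_prod]
  refine Nat.card_congr ⟨fun c => (c.1 none, ⟨fun x => c.1 (some x), fun x => ?_⟩),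
    fun p => ⟨fun o => o.elim p.1 p.2.1, ?_⟩, ?_, ?_⟩
  · simpa using c.2 (some x)
  · rintro (_ | x)
    · simp
    · simpa using p.2.2 x
  · rintro ⟨c, hc⟩
    ext (_ | x) <;> rfl
  · rintro ⟨a, c, hc⟩
    rfl

/-- Multiplying by the transposition inserts `none` into the cycle of `y`, so its colour is forced.
-/
theorem invariantColorings_decomposeOption_some [DecidableEq X] (y : X) (ρ : Perm X) :
    invariantColorings K (Perm.decomposeOption.symm (some y, ρ)) =
      invariantColorings K ρ := by
  have key : ∀ c : Option X → K, c none = c (some y) → ∀ o, c (swap none (some y) o) = c o := by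
    intro c hc o
    by_cases h₁ : o = none
    · subst h₁; simp [hc]
    by_cases h₂ : o = some y
    · subst h₂; simp [hc]
    rw [swap_apply_of_ne_of_ne h₁ h₂]
  refine Nat.card_congr ⟨fun c => ⟨fun x => c.1 (some x), fun x => ?_⟩,
    fun p => ⟨fun o => o.elim (p.1 y) p.1, ?_⟩, ?_, ?_⟩
  · have h0 : c.1 none = c.1 (some y) := by simpa using (c.2 none).symm
    have := c.2 (some x)
    simpa [key _ h0] using this
  · intro o
    simp only [Perm.decomposeOption_symm_apply, Perm.mul_apply]
    refine (key (fun o => o.elim (p.1 y) p.1) rfl _).trans ?_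
    rcases o with (_ | x)
    · simp
    · simpa using p.2 x
  · rintro ⟨c, hc⟩
    have h0 : c none = c (some y) := by simpa using (hc none).symm
    ext (_ | x)
    · exact h0.symm
    · rfl
  · rintro ⟨c, hc⟩
    rfl

/-- A permutation of `k + 1` points arises from one of `k` points by adding a fixed point (factor
`N`) or inserting the new point before one of the `k` others (each changing the sign). Even `e`
gives the rising factorial, odd `e` the falling one. -/
theorem sum_sign_pow_mul_invariantColorings (e N : ℕ) (X : Type*) [Fintype X] [DecidableEq X] :
    ∑ ρ : Perm X, (Perm.sign ρ : ℤ) ^ e * invariantColorings (Fin N) ρ =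
      ∏ i ∈ Finset.range (Fintype.card X), ((N : ℤ) + (-1) ^ e * i) := by
  classical
  have main : ∀ k : ℕ, ∑ ρ : Perm (Fin k), (Perm.sign ρ : ℤ) ^ e * invariantColorings (Fin N) ρ =
      ∏ i ∈ Finset.range k, ((N : ℤ) + (-1) ^ e * i) := by
    intro k
    induction k with
    | zero => simp [invariantColorings]
    | succ k ih =>
      have h1 : ∑ ρ : Perm (Fin (k + 1)), (Perm.sign ρ : ℤ) ^ e * invariantColorings (Fin N) ρ =
          ∑ ρ : Perm (Option (Fin k)),
            (Perm.sign ρ : ℤ) ^ e * invariantColorings (Fin N) ρ := by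
        refine Fintype.sum_equiv (finSuccEquiv k).permCongr _ _ fun ρ => ?_
        rw [Perm.sign_permCongr, invariantColorings_congr (Fin N) (finSuccEquiv k) ρ
          ((finSuccEquiv k).permCongr ρ) (by simp)]
      rw [h1, ← Perm.decomposeOption.symm.sum_comp, Fintype.sum_prod_type, Fintype.sum_option,
        Finset.prod_range_succ, ← ih]
      simp only [invariantColorings_decomposeOption_none, invariantColorings_decomposeOption_some,
        Perm.decomposeOption_symm_sign]
      simp [mul_add, Finset.sum_mul, Finset.mul_sum]
      congr 1
      · exact Finset.sum_congr rfl fun _ _ => by ring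
      · exact Finset.sum_congr rfl fun _ _ => by ring
  rw [← main]
  refine Fintype.sum_equiv (Fintype.equivFin X).permCongr _ _ fun ρ => ?_
  rw [Perm.sign_permCongr,
    invariantColorings_congr (Fin N) (Fintype.equivFin X) ρ
      ((Fintype.equivFin X).permCongr ρ) (by simp)]

/-- Multiplying by a transposition that joins two cycles. -/
theorem card_mul_invariantColorings_swap_mul [Finite X] [DecidableEq X] [AddCommGroup K]
    {S : Set X} {ρ : Perm X} (hρ : ∀ z, ρ z ∈ S ↔ z ∈ S) {x y : X} (hx : x ∈ S) (hy : y ∉ S) :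
    Nat.card K * invariantColorings K (swap x y * ρ) = invariantColorings K ρ := by
  classical
  have swap_inv : ∀ c : X → K, c x = c y → ∀ z, c (swap x y z) = c z := by
    intro c hc z
    by_cases h₁ : z = x
    · subst h₁; simp [hc]
    by_cases h₂ : z = y
    · subst h₂; simp [hc]
    rw [swap_apply_of_ne_of_ne h₁ h₂]
  have hxy : ∀ c : X → K, (∀ z, c ((swap x y * ρ) z) = c z) → c x = c y := by
    intro c hc
    -- Follow the `ρ`-orbit of `x`: it stays in `S`, so it misses `y`, and the colour is preserved
    -- until the orbit returns to `x`, where the transposition jumps to `y`.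
    have step : ∀ k : ℕ, (ρ ^ (k + 1)) x ∈ S ∧ c (swap x y ((ρ ^ (k + 1)) x)) = c x ∨
        c x = c y := by
      intro k
      induction k with
      | zero => exact Or.inl ⟨by simpa [hρ] using hx, by simpa using hc x⟩
      | succ k ih =>
        rcases ih with ⟨h₁, h₂⟩ | h
        · by_cases hk : (ρ ^ (k + 1)) x = x
          · right
            rw [hk, swap_apply_left] at h₂
            exact h₂.symm
          · left
            rw [swap_apply_of_ne_of_ne hk (fun h => hy (by rwa [h] at h₁))] at h₂
            rw [pow_succ' ρ (k + 1), Perm.mul_apply, hρ]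
            exact ⟨h₁, (hc _).trans h₂⟩
        · exact Or.inr h
    have hfin := isOfFinOrder_of_finite ρ
    rcases step (orderOf ρ - 1) with ⟨_, h⟩ | h
    · rw [Nat.sub_add_cancel hfin.orderOf_pos, pow_orderOf_eq_one] at h
      simpa using h.symm
    · exact h
  unfold invariantColorings
  rw [← Nat.card_prod]
  have hind : ∀ z, S.indicator (fun _ => (1 : ℤ)) (ρ z) = S.indicator (fun _ => 1) z := by
    intro z
    by_cases hz : z ∈ S
    · rw [Set.indicator_of_mem hz, Set.indicator_of_mem ((hρ z).2 hz)]
    · rw [Set.indicator_of_notMem hz, Set.indicator_of_notMem (fun h => hz ((hρ z).1 h))]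
  -- Adding a constant `a` on `S` turns a colouring with `c x = c y` into an arbitrary `ρ`-invariant
  -- one; `a` is recovered as the difference of the colours at `x` and `y`.
  let i : X → ℤ := S.indicator fun _ => 1
  have hix : i x = 1 := Set.indicator_of_mem hx _
  have hiy : i y = 0 := Set.indicator_of_notMem hy _
  refine Nat.card_congr ⟨fun p => ⟨fun z => p.2.1 z + i z • p.1, fun z => ?_⟩,
    fun c => (c.1 x - c.1 y, ⟨fun z => c.1 z - i z • (c.1 x - c.1 y), fun z => ?_⟩), ?_, ?_⟩
  · obtain ⟨a, c, hc⟩ := p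
    have h := hc z
    rw [Perm.mul_apply, swap_inv c (hxy c hc)] at h
    simp only [i, hind, h]
  · obtain ⟨c, hc⟩ := c
    refine (swap_inv (fun z => c z - i z • (c x - c y)) (by simp [hix, hiy]) _).trans ?_
    simp only [i, hind, hc]
  · rintro ⟨a, c, hc⟩
    have h := hxy c hc
    ext z <;> simp [hix, hiy, h]
  · rintro ⟨c, hc⟩
    ext z
    simp

theorem invariantColorings_eq_mul [Finite X] [Finite K] (p : X → Prop) (ρ : Perm X)
    (hρ : ∀ z, p (ρ z) ↔ p z) :
    invariantColorings K ρ = invariantColorings K (ρ.subtypePerm hρ) *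
      invariantColorings K (ρ.subtypePerm (p := fun z => ¬ p z) fun z => not_congr (hρ z)) := by
  classical
  unfold invariantColorings
  rw [← Nat.card_prod]
  refine Nat.card_congr ⟨fun c => (⟨fun z => c.1 z, fun z => c.2 z⟩, ⟨fun z => c.1 z, fun z => c.2 z⟩),
    fun q => ⟨fun z => if h : p z then q.1.1 ⟨z, h⟩ else q.2.1 ⟨z, h⟩, fun z => ?_⟩, ?_, ?_⟩
  · by_cases h : p z
    · simp only [dif_pos h, dif_pos ((hρ z).2 h)]
      exact q.1.2 ⟨z, h⟩
    · simp only [dif_neg h, dif_neg (fun h' => h ((hρ z).1 h'))]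
      exact q.2.2 ⟨z, h⟩
  · rintro ⟨c, hc⟩
    ext z
    simp
  · rintro ⟨⟨c, hc⟩, ⟨d, hd⟩⟩
    ext ⟨z, h⟩
    · simp [h]
    · simp [h]

end Colorings

/-! ### Signs on stable subsets and the expansion of the long-cycle indicator -/

section SignOn

variable {X : Type*}

theorem stable_mul_iff {S : Finset X} {α γ : Perm X} (hα : ∀ x, α x ∈ S ↔ x ∈ S) :
    (∀ x, (α * γ) x ∈ S ↔ x ∈ S) ↔ ∀ x, γ x ∈ S ↔ x ∈ S :=
  forall_congr' fun x => by rw [Perm.mul_apply, hα]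

theorem stable_of_forall_mem_iff_sameCycle {C : Finset X} {γ : Perm X} {y : X}
    (hC : ∀ x, x ∈ C ↔ γ.SameCycle y x) (x : X) : γ x ∈ C ↔ x ∈ C := by
  rw [hC, hC, Perm.sameCycle_apply_right]

variable [Fintype X] [DecidableEq X]

/-- The sign of the restriction of `γ` to `S` if `S` is stable under `γ`, and `0` otherwise. -/
def signOn (S : Finset X) (γ : Perm X) : ℤ :=
  if h : ∀ x, γ x ∈ S ↔ x ∈ S then (Perm.sign (γ.subtypePerm h) : ℤ) else 0

theorem signOn_ne_zero_iff {S : Finset X} {γ : Perm X} :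
    signOn S γ ≠ 0 ↔ ∀ x, γ x ∈ S ↔ x ∈ S := by
  unfold signOn
  split_ifs with h <;> simp [h]

theorem signOn_mul {S : Finset X} {α : Perm X} (hα : ∀ x, α x ∈ S ↔ x ∈ S) (γ : Perm X) :
    signOn S (α * γ) = signOn S α * signOn S γ := by
  by_cases h : ∀ x, γ x ∈ S ↔ x ∈ S
  · have h' := (stable_mul_iff hα).2 h
    rw [signOn, dif_pos h', signOn, dif_pos hα, signOn, dif_pos h, ← Units.val_mul,
      ← Perm.sign_mul, Perm.subtypePerm_mul]
  · have h' := mt (stable_mul_iff hα).1 h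
    rw [signOn, dif_neg h', signOn.eq_1 S γ, dif_neg h, mul_zero]

theorem signOn_inv (S : Finset X) (γ : Perm X) : signOn S γ⁻¹ = signOn S γ := by
  by_cases h : ∀ x, γ x ∈ S ↔ x ∈ S
  · have h' : ∀ x, γ⁻¹ x ∈ S ↔ x ∈ S := fun x => by simpa using (h (γ⁻¹ x)).symm
    rw [signOn, dif_pos h', signOn, dif_pos h, ← Perm.sign_inv, Perm.subtypePerm_inv, inv_inv]
  · have h' : ¬ ∀ x, γ⁻¹ x ∈ S ↔ x ∈ S := fun h' => h fun x => by
      simpa using (h' (γ x)).symm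
    rw [signOn, dif_neg h', signOn, dif_neg h]

theorem signOn_mul_right {S : Finset X} {α : Perm X} (hα : ∀ x, α x ∈ S ↔ x ∈ S) (γ : Perm X) :
    signOn S (γ * α) = signOn S γ * signOn S α := by
  have hα' : ∀ x, α⁻¹ x ∈ S ↔ x ∈ S := fun x => by simpa using (hα (α⁻¹ x)).symm
  rw [← signOn_inv, mul_inv_rev, signOn_mul hα', signOn_inv, signOn_inv, mul_comm]

theorem signOn_eq_sign {S : Finset X} {γ δ : Perm X} (hγ : ∀ x, γ x ∈ S ↔ x ∈ S)
    (h : ∀ x ∈ S, γ x = δ x) (hδ : ∀ x ∉ S, δ x = x) : signOn S γ = Perm.sign δ := by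
  rw [signOn, dif_pos hγ, ← Perm.sign_ofSubtype]
  congr 2
  ext x
  by_cases hx : x ∈ S
  · rw [Perm.ofSubtype_apply_of_mem _ hx, ← h x hx]
    rfl
  · rw [Perm.ofSubtype_apply_of_not_mem _ hx, hδ x hx]

/-- Only the `γ` preserving `S` contribute, and these are pairs of permutations of `S` and its
complement: the signed sum over the first factor is falling, the unsigned sum over the second is
rising. -/
theorem sum_signOn_mul_invariantColorings (S : Finset X) (N : ℕ) :
    ∑ γ : Perm X, signOn S γ * invariantColorings (Fin N) γ =
      (∏ i ∈ Finset.range S.card, ((N : ℤ) - i)) *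
        ∏ i ∈ Finset.range (Fintype.card X - S.card), ((N : ℤ) + i) := by
  have h1 := sum_sign_pow_mul_invariantColorings 1 N {x // x ∈ S}
  have h0 := sum_sign_pow_mul_invariantColorings 0 N {x // ¬ x ∈ S}
  rw [Fintype.card_coe] at h1
  rw [Fintype.card_subtype_compl, Fintype.card_coe] at h0
  simp only [pow_one, neg_one_mul, ← sub_eq_add_neg] at h1
  simp only [pow_zero, one_mul] at h0
  rw [← h1, ← h0, Finset.sum_mul_sum, ← Fintype.sum_prod_type']
  symm
  have hstab : ∀ p : Perm {x // x ∈ S} × Perm {x // ¬ x ∈ S},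
      ∀ x, p.1.subtypeCongr p.2 x ∈ S ↔ x ∈ S := by
    intro p x
    by_cases hx : x ∈ S
    · rw [Perm.subtypeCongr.left_apply _ _ hx]
      exact iff_of_true (p.1 _).2 hx
    · rw [Perm.subtypeCongr.right_apply _ _ hx]
      exact iff_of_false (p.2 _).2 hx
  refine Finset.sum_of_injOn (fun p => p.1.subtypeCongr p.2) ?_ (fun _ _ => Finset.mem_univ _) ?_ ?_
  · exact (Perm.subtypeCongrHom_injective _).injOn
  · intro γ _ hγ
    by_contra h
    have hs : ∀ x, γ x ∈ S ↔ x ∈ S := signOn_ne_zero_iff.1 (left_ne_zero_of_mul h)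
    refine hγ ⟨(γ.subtypePerm hs, γ.subtypePerm (p := fun z => ¬ z ∈ S) fun z => not_congr (hs z)),
      by simp, ?_⟩
    ext x
    by_cases hx : x ∈ S
    · simp only [Perm.subtypeCongr.left_apply _ _ hx]
      rfl
    · simp only [Perm.subtypeCongr.right_apply _ _ hx]
      rfl
  · rintro p -
    rw [invariantColorings_eq_mul (· ∈ S) _ (hstab p), signOn, dif_pos (hstab p)]
    have e1 : (p.1.subtypeCongr p.2).subtypePerm (hstab p) = p.1 := by
      ext x
      simp
    have e2 : (p.1.subtypeCongr p.2).subtypePerm (p := fun z => ¬ z ∈ S)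
        (fun z => not_congr (hstab p z)) = p.2 := by
      ext x
      simp
    rw [e1, e2]
    push_cast
    ring

theorem sum_signOn_of_stable {S : Finset X} {α : Perm X} (hα : ∀ x, α x ∈ S ↔ x ∈ S) (N : ℕ) :
    ∑ γ : Perm X, signOn S γ * invariantColorings (Fin N) (α⁻¹ * γ) =
      signOn S α * ((∏ i ∈ Finset.range S.card, ((N : ℤ) - i)) *
        ∏ i ∈ Finset.range (Fintype.card X - S.card), ((N : ℤ) + i)) := by
  rw [← sum_signOn_mul_invariantColorings, Finset.mul_sum,
    ← Equiv.sum_comp (Equiv.mulLeft α)]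
  refine Finset.sum_congr rfl fun γ _ => ?_
  rw [Equiv.coe_mulLeft, signOn_mul hα, inv_mul_cancel_left, mul_assoc]

theorem mul_sum_signOn_of_stable_mul_swap {S : Finset X} {α : Perm X}
    (hα : ∀ x, α x ∈ S ↔ x ∈ S) {x y : X} (hx : x ∈ S) (hy : y ∉ S) (N : ℕ) [NeZero N] :
    N * ∑ γ : Perm X, signOn S γ * invariantColorings (Fin N) ((α * swap x y)⁻¹ * γ) =
      signOn S α * ((∏ i ∈ Finset.range S.card, ((N : ℤ) - i)) *
        ∏ i ∈ Finset.range (Fintype.card X - S.card), ((N : ℤ) + i)) := by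
  rw [← sum_signOn_mul_invariantColorings, Finset.mul_sum, Finset.mul_sum,
    ← Equiv.sum_comp (Equiv.mulLeft α)]
  refine Finset.sum_congr rfl fun γ _ => ?_
  rw [Equiv.coe_mulLeft, signOn_mul hα, mul_inv_rev, swap_inv, mul_assoc (swap x y),
    inv_mul_cancel_left]
  by_cases h : signOn S γ = 0
  · simp [h]
  · have := card_mul_invariantColorings_swap_mul (K := Fin N) (S := (S : Set X)) (ρ := γ)
      (by simpa using signOn_ne_zero_iff.1 h) (by simpa using hx) (by simpa using hy)
    rw [Nat.card_fin] at this
    rw [← this]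
    push_cast
    ring

/-- Replace `γ` by `(αx αy) γ (x y)`. This conjugates `α⁻¹γ` by `(x y)`, so the colouring count is
unchanged, while the sign on `S` flips: `(x y)` acts inside `S` and `(αx αy)` outside it. -/
theorem sum_signOn_eq_zero {S : Finset X} {α : Perm X} {x y : X} (hxy : x ≠ y) (hx : x ∈ S)
    (hy : y ∈ S) (hx' : α x ∉ S) (hy' : α y ∉ S) (K : Type*) :
    ∑ γ : Perm X, signOn S γ * invariantColorings K (α⁻¹ * γ) = 0 := by
  have hs : ∀ z, swap x y z ∈ S ↔ z ∈ S := by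
    intro z
    rcases eq_or_ne z x with rfl | h₁
    · simp [hx, hy]
    rcases eq_or_ne z y with rfl | h₂
    · simp [hx, hy]
    rw [swap_apply_of_ne_of_ne h₁ h₂]
  have hu' : ∀ z ∈ S, swap (α x) (α y) z = z := fun z hz =>
    swap_apply_of_ne_of_ne (fun h => hx' (h ▸ hz)) (fun h => hy' (h ▸ hz))
  have hu : ∀ z, swap (α x) (α y) z ∈ S ↔ z ∈ S := by
    intro z
    rcases eq_or_ne z (α x) with rfl | h₁
    · simp [hx', hy']
    rcases eq_or_ne z (α y) with rfl | h₂
    · simp [hx', hy']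
    rw [swap_apply_of_ne_of_ne h₁ h₂]
  have h1 : signOn S (swap x y) = -1 := by
    rw [signOn_eq_sign hs (fun _ _ => rfl), Perm.sign_swap hxy]
    · rfl
    · exact fun z hz => swap_apply_of_ne_of_ne (fun h => hz (h ▸ hx)) (fun h => hz (h ▸ hy))
  have h2 : signOn S (swap (α x) (α y)) = 1 := by
    rw [signOn_eq_sign hu (δ := 1) (fun z hz => hu' z hz) (fun _ _ => rfl), Perm.sign_one]
    rfl
  have key : ∑ γ : Perm X, signOn S γ * invariantColorings K (α⁻¹ * γ) =
      -∑ γ : Perm X, signOn S γ * invariantColorings K (α⁻¹ * γ) := by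
    conv_lhs => rw [← ((Equiv.mulLeft (swap (α x) (α y))).trans
      (Equiv.mulRight (swap x y))).sum_comp]
    rw [← Finset.sum_neg_distrib]
    refine Finset.sum_congr rfl fun γ _ => ?_
    rw [Equiv.trans_apply, Equiv.coe_mulLeft, Equiv.coe_mulRight, signOn_mul_right hs,
      signOn_mul hu, h1, h2]
    have : α⁻¹ * (swap (α x) (α y) * γ * swap x y) =
        swap x y * (α⁻¹ * γ) * (swap x y)⁻¹ := by
      rw [swap_apply_apply, swap_inv]
      group
    rw [this, invariantColorings_conj]
    ring
  omega

theorem signOn_union {S T : Finset X} (hST : Disjoint S T) {γ : Perm X}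
    (hS : ∀ x, γ x ∈ S ↔ x ∈ S) (hT : ∀ x, γ x ∈ T ↔ x ∈ T) :
    signOn (S ∪ T) γ = signOn S γ * signOn T γ := by
  have hU : ∀ x, γ x ∈ S ∪ T ↔ x ∈ S ∪ T := fun x => by
    rw [Finset.mem_union, Finset.mem_union, hS, hT]
  rw [signOn_eq_sign (S := S ∪ T) (δ := Perm.ofSubtype (γ.subtypePerm hS) *
    Perm.ofSubtype (γ.subtypePerm hT)) hU]
  · rw [Perm.sign_mul, Perm.sign_ofSubtype, Perm.sign_ofSubtype, signOn, dif_pos hS, signOn,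
      dif_pos hT, Units.val_mul]
  · intro x hx
    rw [Perm.mul_apply]
    by_cases h : x ∈ T
    · rw [Perm.ofSubtype_apply_of_mem _ h, Perm.ofSubtype_apply_of_not_mem]
      · rfl
      · exact fun h' => Finset.disjoint_left.1 hST h' ((hT x).2 h)
    · rw [Perm.ofSubtype_apply_of_not_mem _ h, Perm.ofSubtype_apply_of_mem _
        ((Finset.mem_union.1 hx).resolve_right h)]
      rfl
  · intro x hx
    rw [Finset.mem_union, not_or] at hx
    rw [Perm.mul_apply, Perm.ofSubtype_apply_of_not_mem _ hx.2,
      Perm.ofSubtype_apply_of_not_mem _ hx.1]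

theorem neg_one_pow_card_mul_signOn_cycle {C : Finset X} {γ : Perm X} {y : X}
    (hC : ∀ x, x ∈ C ↔ γ.SameCycle y x) : (-1) ^ C.card * signOn C γ = -1 := by
  rw [signOn_eq_sign (δ := γ.cycleOf y) (stable_of_forall_mem_iff_sameCycle hC)]
  · by_cases hy : γ y = y
    · have : C = {y} := by
        ext x
        rw [hC, Finset.mem_singleton]
        exact ⟨fun h => (h.eq_of_left hy).symm, fun h => h ▸ Perm.SameCycle.refl _ _⟩
      rw [(Perm.cycleOf_eq_one_iff γ).2 hy, this]
      simp
    · have : C = (γ.cycleOf y).support := by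
        ext x
        rw [hC, Perm.mem_support_cycleOf_iff' hy]
      rw [(Perm.isCycle_cycleOf γ hy).sign, ← this]
      push_cast
      rw [mul_neg, ← mul_pow]
      simp
  · exact fun x hx => ((hC x).1 hx).cycleOf_apply.symm
  · exact fun x hx => Perm.cycleOf_apply_of_not_sameCycle (mt (hC x).2 hx)

/-- The indicator function of the long cycles, expanded over the stable subsets. -/
theorem sum_neg_one_pow_card_mul_signOn (r : X) (γ : Perm X)
    [Decidable (γ.IsCycleOn Set.univ)] :
    ∑ S ∈ (Finset.univ.erase r).powerset, (-1) ^ S.card * signOn S γ =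
      if γ.IsCycleOn Set.univ then 1 else 0 := by
  classical
  -- For a long cycle, the only stable set avoiding `r` is empty.
  split_ifs with hγ
  · rw [Finset.sum_eq_single ∅]
    · rw [signOn_eq_sign (δ := 1)] <;> simp
    · intro S hS hne
      by_contra h
      have hs := signOn_ne_zero_iff.1 (right_ne_zero_of_mul h)
      obtain ⟨x, hx⟩ := Finset.nonempty_iff_ne_empty.2 hne
      obtain ⟨k, hk⟩ := hγ.2 (Set.mem_univ x) (Set.mem_univ r)
      have : r ∈ S := by
        have h3 := invariant_zpow (c := fun z => z ∈ S) (ρ := γ) (fun z => propext (hs z)) k x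
        simp only [hk] at h3
        exact h3.symm ▸ hx
      exact Finset.notMem_erase r _ (Finset.mem_powerset.1 hS this)
    · simp
  -- Otherwise some cycle `C` avoids `r`. Adding or removing `C` is an involution on the stable sets
  -- avoiding `r`, and it reverses the sign of the term because an `ℓ`-cycle has sign `(-1)^(ℓ-1)`.
  · obtain ⟨y, hy⟩ : ∃ y, ¬ γ.SameCycle y r := by
      by_contra! h
      exact hγ ⟨by simp, fun x _ z _ => (h x).trans (h z).symm⟩
    let C : Finset X := Finset.univ.filter fun x => γ.SameCycle y x
    have hC : ∀ x, x ∈ C ↔ γ.SameCycle y x := fun x => by simp [C]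
    have hyC : y ∈ C := (hC y).2 (Perm.SameCycle.refl _ _)
    have hCst := stable_of_forall_mem_iff_sameCycle hC
    have stab : ∀ S : Finset X, signOn S γ ≠ 0 → ∀ x ∈ C, x ∈ S ↔ y ∈ S := by
      intro S hS x hx
      obtain ⟨k, rfl⟩ := (hC x).1 hx
      exact iff_of_eq (invariant_zpow (c := fun z => z ∈ S) (ρ := γ)
        (fun z => propext (signOn_ne_zero_iff.1 hS z)) k y)
    have pair : ∀ S : Finset X, signOn S γ ≠ 0 → y ∉ S →
        (-1) ^ (symmDiff S C).card * signOn (symmDiff S C) γ = -((-1) ^ S.card * signOn S γ) := by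
      intro S hS hyS
      have hd : Disjoint S C := Finset.disjoint_right.2 fun x hx h => hyS ((stab S hS x hx).1 h)
      rw [hd.symmDiff_eq_sup, Finset.sup_eq_union, Finset.card_union_of_disjoint hd,
        signOn_union hd (signOn_ne_zero_iff.1 hS) hCst, pow_add, mul_mul_mul_comm,
        neg_one_pow_card_mul_signOn_cycle hC]
      ring
    have symm_ne : ∀ S : Finset X, signOn S γ ≠ 0 → signOn (symmDiff S C) γ ≠ 0 := by
      intro S hS
      rw [signOn_ne_zero_iff] at hS ⊢
      intro x
      rw [Finset.mem_symmDiff, Finset.mem_symmDiff, hS, hCst]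
    have hsum : ∑ S ∈ (Finset.univ.erase r).powerset.filter (fun S => signOn S γ ≠ 0),
        (-1) ^ S.card * signOn S γ = 0 := by
      refine Finset.sum_involution (fun S _ => symmDiff S C) ?_ ?_ ?_ ?_
      · intro S hS
        have hS0 := (Finset.mem_filter.1 hS).2
        by_cases hyS : y ∈ S
        · have := pair _ (symm_ne S hS0) (by simp [Finset.mem_symmDiff, hyS, hyC])
          rw [symmDiff_symmDiff_cancel_right] at this
          rw [this]
          ring
        · rw [pair S hS0 hyS]
          ring
      · intro S _ _ h
        rw [symmDiff_eq_left] at h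
        rw [h] at hyC
        exact Finset.notMem_empty _ hyC
      · intro S hS
        rw [Finset.mem_filter, Finset.mem_powerset] at hS ⊢
        refine ⟨fun x hx => ?_, symm_ne S hS.2⟩
        rcases Finset.mem_symmDiff.1 hx with h | h
        · exact hS.1 h.1
        · refine Finset.mem_erase.2 ⟨?_, Finset.mem_univ _⟩
          rintro rfl
          exact hy ((hC x).1 h.1)
      · intro S _
        exact symmDiff_symmDiff_cancel_right _ _
    rw [← hsum, Finset.sum_filter_of_ne]
    exact fun S _ h => right_ne_zero_of_mul h

end SignOn

/-! ### Subsets of half-edges relative to the edges -/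

section EdgeFlip

variable {ι : Type*}

theorem card_product_bool (T : Finset ι) : (T ×ˢ (Finset.univ : Finset Bool)).card = 2 * T.card := by
  simp [mul_comm]

variable [DecidableEq ι]

/-- The permutation of `ι × Bool` that exchanges the two half-edges of each edge in `T`. -/
def edgeFlip (T : Finset ι) : Perm (ι × Bool) :=
  prodCongrRight fun i => if i ∈ T then boolNot else 1

theorem edgeFlip_of_mem {T : Finset ι} {x : ι × Bool} (h : x.1 ∈ T) :
    edgeFlip T x = (x.1, !x.2) := by
  simp [edgeFlip, prodCongrRight, h]

theorem edgeFlip_of_notMem {T : Finset ι} {x : ι × Bool} (h : x.1 ∉ T) : edgeFlip T x = x := by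
  simp [edgeFlip, prodCongrRight, h]

theorem card_insert_product_bool {T : Finset ι} {x : ι × Bool} (hx : x.1 ∉ T) :
    (insert x (T ×ˢ (Finset.univ : Finset Bool))).card = 2 * T.card + 1 := by
  rw [Finset.card_insert_of_notMem (by simp [hx])]
  simp [mul_comm]

/-- The half-edges of `S` whose opposite half-edge is not in `S`. -/
def unpaired (S : Finset (ι × Bool)) : Finset (ι × Bool) :=
  S.filter fun x => (x.1, !x.2) ∉ S

theorem mem_unpaired {S : Finset (ι × Bool)} {x : ι × Bool} :
    x ∈ unpaired S ↔ x ∈ S ∧ (x.1, !x.2) ∉ S := by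
  simp [unpaired]

theorem mk_mem_of_notMem_unpaired {S : Finset (ι × Bool)} {x : ι × Bool} (b : Bool) (hx : x ∈ S)
    (h : x ∉ unpaired S) : (x.1, b) ∈ S := by
  rw [mem_unpaired, not_and, not_not] at h
  obtain ⟨i, c⟩ := x
  cases b <;> cases c <;> first | exact hx | exact h hx

theorem unpaired_insert_product {T : Finset ι} {x : ι × Bool} (hx : x.1 ∉ T) :
    unpaired (insert x (T ×ˢ Finset.univ)) = {x} := by
  ext z
  rw [mem_unpaired, Finset.mem_singleton]
  constructor
  · rintro ⟨h, h'⟩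
    refine (Finset.mem_insert.1 h).resolve_right fun h => h' ?_
    simp at h
    simp [h]
  · rintro rfl
    simpa [hx] using fun h => by simpa using congrArg Prod.snd h

variable [Fintype ι]

theorem sign_edgeFlip (T : Finset ι) : (Perm.sign (edgeFlip T) : ℤ) = (-1) ^ T.card := by
  have h : Perm.sign boolNot = -1 := by decide
  rw [edgeFlip, Perm.sign_prodCongrRight, Units.coe_prod]
  simp [apply_ite, h]

theorem edgeFlip_univ (x : ι × Bool) : edgeFlip Finset.univ x = (x.1, !x.2) :=
  edgeFlip_of_mem (Finset.mem_univ _)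

theorem edgeFlip_univ_mem_product (T : Finset ι) (x : ι × Bool) :
    edgeFlip Finset.univ x ∈ T ×ˢ Finset.univ ↔ x ∈ T ×ˢ Finset.univ := by
  simp [edgeFlip_univ]

theorem sum_signOn_product (T : Finset ι) (N : ℕ) :
    ∑ γ : Perm (ι × Bool), signOn (T ×ˢ Finset.univ) γ *
        invariantColorings (Fin N) ((edgeFlip Finset.univ)⁻¹ * γ) =
      (-1) ^ T.card * ((∏ i ∈ Finset.range (2 * T.card), ((N : ℤ) - i)) *
        ∏ i ∈ Finset.range (2 * Fintype.card ι - 2 * T.card), ((N : ℤ) + i)) := by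
  rw [sum_signOn_of_stable (edgeFlip_univ_mem_product T), card_product_bool,
    Fintype.card_prod, Fintype.card_bool, mul_comm (Fintype.card ι),
    signOn_eq_sign (edgeFlip_univ_mem_product T) (δ := edgeFlip T), sign_edgeFlip]
  · intro x hx
    rw [edgeFlip_univ, edgeFlip_of_mem (by simpa using hx)]
  · intro x hx
    exact edgeFlip_of_notMem (by simpa using hx)

theorem mul_sum_signOn_insert_product {T : Finset ι} {x : ι × Bool} (hx : x.1 ∉ T) (N : ℕ)
    [NeZero N] :
    N * ∑ γ : Perm (ι × Bool), signOn (insert x (T ×ˢ Finset.univ)) γ *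
        invariantColorings (Fin N) ((edgeFlip Finset.univ)⁻¹ * γ) =
      (-1) ^ T.card * ((∏ i ∈ Finset.range (2 * T.card + 1), ((N : ℤ) - i)) *
        ∏ i ∈ Finset.range (2 * Fintype.card ι - (2 * T.card + 1)), ((N : ℤ) + i)) := by
  -- Split off the flip of the edge of `x`: the flip of the other edges preserves the set, and the
  -- remaining transposition crosses its boundary.
  have hα : edgeFlip (Finset.univ : Finset ι) =
      edgeFlip (Finset.univ.erase x.1) * swap x (x.1, !x.2) := by
    ext1 z
    rw [edgeFlip_univ, Perm.mul_apply]
    rcases eq_or_ne z x with rfl | h₁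
    · rw [swap_apply_left, edgeFlip_of_notMem (by simp)]
    rcases eq_or_ne z (x.1, !x.2) with rfl | h₂
    · rw [swap_apply_right, edgeFlip_of_notMem (by simp)]
      simp
    rw [swap_apply_of_ne_of_ne h₁ h₂, edgeFlip_of_mem]
    rw [Finset.mem_erase]
    refine ⟨fun h => ?_, Finset.mem_univ _⟩
    obtain ⟨z₁, z₂⟩ := z
    obtain ⟨x₁, x₂⟩ := x
    simp only at h
    subst h
    cases z₂ <;> cases x₂ <;> simp at h₁ h₂
  have hst : ∀ z, edgeFlip (Finset.univ.erase x.1) z ∈ insert x (T ×ˢ Finset.univ) ↔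
      z ∈ insert x (T ×ˢ (Finset.univ : Finset Bool)) := by
    intro z
    by_cases h : z.1 = x.1
    · rw [edgeFlip_of_notMem (by simp [h])]
    · rw [edgeFlip_of_mem (by simp [h])]
      have h₁ : z ≠ x := fun h' => h (h' ▸ rfl)
      have h₂ : (z.1, !z.2) ≠ x := fun h' => h (h' ▸ rfl)
      simp [h₁, h₂]
  rw [hα, mul_sum_signOn_of_stable_mul_swap hst (Finset.mem_insert_self _ _),
    card_insert_product_bool hx, Fintype.card_prod, Fintype.card_bool, mul_comm (Fintype.card ι),
    signOn_eq_sign hst (δ := edgeFlip T), sign_edgeFlip]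
  · intro z hz
    rcases Finset.mem_insert.1 hz with rfl | hz
    · rw [edgeFlip_of_notMem (by simp), edgeFlip_of_notMem hx]
    · have hz : z.1 ∈ T := by simpa using hz
      rw [edgeFlip_of_mem hz, edgeFlip_of_mem]
      simpa using fun h : z.1 = x.1 => hx (h ▸ hz)
  · intro z hz
    refine edgeFlip_of_notMem fun h => hz ?_
    simp [h]
  · rw [Finset.mem_insert]
    rintro (h | h)
    · simpa using congrArg Prod.snd h
    · simp [hx] at h

/-- Sets with at most one unpaired half-edge are unions of edges, possibly with one extra half-edge
`x`. Whole edges must avoid the edge of `r`, but `x` may be the partner of `r`. -/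
theorem sum_powerset_eq_of_two_unpaired (r : ι × Bool) (F : Finset (ι × Bool) → ℤ)
    (hF : ∀ S x y, x ≠ y → x ∈ unpaired S → y ∈ unpaired S → F S = 0) :
    ∑ S ∈ (Finset.univ.erase r).powerset, F S =
      ∑ T ∈ (Finset.univ.erase r.1).powerset, F (T ×ˢ Finset.univ) +
        ∑ x ∈ Finset.univ.erase r, ∑ T ∈ ((Finset.univ.erase r.1).erase x.1).powerset,
          F (insert x (T ×ˢ Finset.univ)) := by
  rw [← Finset.sum_filter_add_sum_filter_not _ (fun S => unpaired S = ∅)]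
  congr 1
  · symm
    refine Finset.sum_of_injOn (fun T => T ×ˢ Finset.univ) ?_ ?_ ?_ (fun _ _ => rfl)
    · intro T _ T' _ h
      ext i
      simpa using congrArg ((i, true) ∈ ·) h
    · intro T hT
      have hT : T ⊆ Finset.univ.erase r.1 := Finset.mem_powerset.1 hT
      simp only [Finset.coe_filter, Finset.mem_powerset, Set.mem_ofPred_eq]
      refine ⟨fun x hx => ?_, ?_⟩
      · refine Finset.mem_erase.2 ⟨?_, Finset.mem_univ _⟩
        rintro rfl
        exact Finset.notMem_erase _ _ (hT (Finset.mem_product.1 hx).1)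
      · ext x
        simp +contextual [mem_unpaired]
    · intro S hS hS'
      refine absurd ⟨S.image Prod.fst, ?_, ?_⟩ hS'
      · rw [Finset.mem_filter, Finset.mem_powerset] at hS
        rw [Finset.mem_coe, Finset.mem_powerset]
        intro i hi
        refine Finset.mem_erase.2 ⟨?_, Finset.mem_univ _⟩
        rintro rfl
        obtain ⟨x, hx, hxr⟩ := Finset.mem_image.1 hi
        have := mk_mem_of_notMem_unpaired r.2 hx (by rw [hS.2]; simp)
        rw [hxr] at this
        exact Finset.notMem_erase _ _ (hS.1 this)
      · rw [Finset.mem_filter] at hS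
        ext ⟨i, b⟩
        simp only [Finset.mem_product, Finset.mem_image, Finset.mem_univ, and_true]
        constructor
        · rintro ⟨x, hx, rfl⟩
          exact mk_mem_of_notMem_unpaired b hx (by rw [hS.2]; simp)
        · exact fun h => ⟨_, h, rfl⟩
  · rw [Finset.sum_sigma']
    symm
    have hmem : ∀ p : (_ : ι × Bool) × Finset ι,
        p ∈ ((Finset.univ.erase r).sigma fun x =>
          ((Finset.univ.erase r.1).erase x.1).powerset : Finset _) → r.1 ∉ p.2 ∧ p.1.1 ∉ p.2 := by
      intro p hp
      rw [Finset.mem_sigma, Finset.mem_powerset] at hp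
      exact ⟨fun h => by simpa using hp.2 h, fun h => by simpa using hp.2 h⟩
    refine Finset.sum_of_injOn (fun p => insert p.1 (p.2 ×ˢ Finset.univ)) ?_ ?_ ?_ (fun _ _ => rfl)
    · rintro ⟨x, T⟩ hp ⟨y, U⟩ hq h
      have hx := (hmem _ hp).2
      have hy := (hmem _ hq).2
      have hxy : x = y := by
        have := congrArg unpaired h
        rwa [unpaired_insert_product hx, unpaired_insert_product hy,
          Finset.singleton_inj] at this
      subst hxy
      have hTU : T ×ˢ (Finset.univ : Finset Bool) = U ×ˢ Finset.univ := by
        rw [← Finset.erase_insert (s := T ×ˢ (Finset.univ : Finset Bool)) (a := x) (by simpa using hx),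
          ← Finset.erase_insert (s := U ×ˢ (Finset.univ : Finset Bool)) (a := x) (by simpa using hy)]
        exact congrArg (Finset.erase · x) h
      have : T = U := by
        ext i
        simpa using congrArg ((i, true) ∈ ·) hTU
      rw [this]
    · rintro ⟨x, T⟩ hp
      obtain ⟨hr, hx⟩ := hmem _ hp
      simp only [Finset.mem_coe, Finset.mem_sigma, Finset.mem_powerset, Finset.mem_erase] at hp
      simp only [Finset.coe_filter, Finset.mem_powerset, Set.mem_ofPred_eq]
      refine ⟨fun z hz => Finset.mem_erase.2 ⟨?_, Finset.mem_univ _⟩, ?_⟩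
      · rintro rfl
        rcases Finset.mem_insert.1 hz with h | h
        · exact hp.1.1 h.symm
        · exact hr (Finset.mem_product.1 h).1
      · rw [unpaired_insert_product hx]
        exact Finset.singleton_ne_empty _
    · intro S hS hS'
      by_contra hne
      rw [Finset.mem_filter, Finset.mem_powerset] at hS
      obtain ⟨x, hx⟩ := Finset.nonempty_iff_ne_empty.2 hS.2
      have huniq : ∀ z ∈ unpaired S, z = x := fun z hz => by
        by_contra h
        exact hne (hF S z x h hz hx)
      have hxS := mem_unpaired.1 hx
      have hfst : ∀ z ∈ S, z ≠ x → z.1 ≠ x.1 := by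
        rintro ⟨i, b⟩ hz hzx rfl
        obtain ⟨j, c⟩ := x
        cases b <;> cases c <;> first | exact hzx rfl | exact hxS.2 hz
      refine hS' ⟨⟨x, (S.erase x).image Prod.fst⟩, ?_, ?_⟩
      · simp only [Finset.mem_coe, Finset.mem_sigma, Finset.mem_powerset]
        refine ⟨hS.1 hxS.1, fun i hi => ?_⟩
        obtain ⟨z, hz, rfl⟩ := Finset.mem_image.1 hi
        rw [Finset.mem_erase] at hz
        refine Finset.mem_erase.2 ⟨hfst z hz.2 hz.1, Finset.mem_erase.2 ⟨fun h => ?_,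
          Finset.mem_univ _⟩⟩
        have := mk_mem_of_notMem_unpaired r.2 hz.2 fun h => hz.1 (huniq z h)
        rw [h] at this
        exact Finset.notMem_erase _ _ (hS.1 this)
      · ext ⟨i, b⟩
        simp only [Finset.mem_insert, Finset.mem_product, Finset.mem_image, Finset.mem_univ,
          and_true, Finset.mem_erase]
        constructor
        · rintro (rfl | ⟨z, hz, rfl⟩)
          · exact hxS.1
          · exact mk_mem_of_notMem_unpaired b hz.2 fun h => hz.1 (huniq z h)
        · intro h
          by_cases hzx : (i, b) = x
          · exact Or.inl hzx
          · exact Or.inr ⟨_, ⟨hzx, h⟩, rfl⟩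

end EdgeFlip

/-! ### Iterated differences and the relation for `P` -/

theorem prod_sub_mul_prod_add (x : ℤ) (a b : ℕ) :
    (∏ i ∈ Finset.range a, (x - i)) * ∏ i ∈ Finset.range (b + 1), (x + i) =
      x * ∏ i ∈ Finset.range (a + b), (x - a + 1 + i) := by
  induction a with
  | zero =>
    rw [Finset.prod_range_succ', mul_comm]
    simp [add_comm, add_left_comm, mul_comm]
  | succ a ih =>
    rw [Finset.prod_range_succ, mul_right_comm, ih, show a + 1 + b = a + b + 1 by ring,
      Finset.prod_range_succ']
    push_cast
    have : ∀ i ∈ Finset.range (a + b), x - (a + 1) + 1 + (i + 1 : ℤ) = x - a + 1 + i :=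
      fun i _ => by ring
    rw [Finset.prod_congr rfl this]
    ring

/-- The `k`-fold iterate of `p(x) ↦ p(x) - p(x - 2)`, applied to
`p(x) = (x + 1) (x + 2) ⋯ (x + 2 m + 1)`. -/
def stepDiff (m : ℕ) : ℕ → ℤ → ℤ
  | 0, x => ∏ i ∈ Finset.range (2 * m + 1), (x + 1 + i)
  | k + 1, x => stepDiff m k x - stepDiff m k (x - 2)

/-- Each element of `U` is either left out or contributes a sign and a shift by `2`, hence one
difference operator per element. -/
theorem sum_powerset_prod_eq_stepDiff {ι : Type*} (m : ℕ) (U : Finset ι) (x : ℤ) :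
    ∑ T ∈ U.powerset, (-1) ^ T.card *
      ∏ i ∈ Finset.range (2 * m + 1), (x - 2 * T.card + 1 + i) = stepDiff m U.card x := by
  classical
  induction U using Finset.induction_on generalizing x with
  | empty => simp [stepDiff]
  | insert a U ha ih =>
    rw [Finset.sum_powerset_insert ha, Finset.card_insert_of_notMem ha, stepDiff, ih, ← ih (x - 2),
      sub_eq_add_neg, ← Finset.sum_neg_distrib]
    congr 1
    refine Finset.sum_congr rfl fun T hT => ?_
    have haT : a ∉ T := fun h => ha (Finset.mem_powerset.1 hT h)
    rw [Finset.card_insert_of_notMem haT, pow_succ, mul_neg_one, neg_mul]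
    push_cast
    rw [show x - 2 * ((T.card : ℤ) + 1) = x - 2 - 2 * T.card by ring]

theorem stepDiff_zero_relation (m : ℕ) (x : ℤ) :
    x * stepDiff m 0 x = (x + 2 * m + 1) * stepDiff m 0 (x - 1) := by
  simp only [stepDiff]
  rw [Finset.prod_range_succ, Finset.prod_range_succ']
  have : ∀ i ∈ Finset.range (2 * m), x - 1 + 1 + ((i + 1 : ℕ) : ℤ) = x + 1 + i :=
    fun i _ => by push_cast; ring
  rw [Finset.prod_congr rfl this]
  push_cast
  ring

/-- The base case adds the shift relation for the product at `x` and `x - 1`. Each further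
difference replaces `x` by `x - 2` in the factor as well, which lowers the last coefficient by `2`.
-/
theorem mul_stepDiff_succ (m k : ℕ) (x : ℤ) :
    x * stepDiff m (k + 1) x =
      (2 * m + 2) * stepDiff m k (x - 1) + (2 * m - 2 * k) * stepDiff m k (x - 2) := by
  induction k generalizing x with
  | zero =>
    have h1 := stepDiff_zero_relation m x
    have h2 := stepDiff_zero_relation m (x - 1)
    rw [show x - 1 - 1 = x - 2 by ring] at h2
    rw [stepDiff.eq_2]
    push_cast
    linear_combination h1 + h2
  | succ k ih =>
    have h1 := ih x
    have h2 := ih (x - 2)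
    rw [stepDiff.eq_2 m x (k + 1), stepDiff.eq_2 m (x - 1) k, stepDiff.eq_2 m (x - 2) k]
    rw [show x - 2 - 1 = x - 1 - 2 by ring] at h2
    rw [stepDiff.eq_2 m (x - 2) k] at h2
    push_cast
    linear_combination h1 - h2

/-- The polynomial function `∑ N ^ (number of vertices)` of one-face maps with `m + 1` edges. -/
def oneFaceSum (m : ℕ) (x : ℤ) : ℤ :=
  x * stepDiff m m x - stepDiff m m (x - 1) - 2 * m * stepDiff m (m - 1) (x - 1)

theorem oneFaceSum_succ (m : ℕ) (x : ℤ) :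
    oneFaceSum (m + 1) x = stepDiff (m + 1) m (x - 1) + 2 * stepDiff (m + 1) m (x - 2) +
      stepDiff (m + 1) m (x - 3) := by
  have h := mul_stepDiff_succ (m + 1) m x
  have h' := stepDiff.eq_2 (m + 1) (x - 1) m
  rw [show x - 1 - 2 = x - 3 by ring] at h'
  rw [oneFaceSum, Nat.add_sub_cancel, h']
  push_cast at h ⊢
  linear_combination h

/-- With the weights `1, 2, 1` of `oneFaceSum_succ`, the right side is `x` times the same weighted
sum of the next difference at `x, x-1, x-2`; `mul_stepDiff_succ` at these points removes the factor
`x`. -/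
theorem oneFaceSum_relation (m : ℕ) (x : ℤ) :
    2 * (m + 2) * oneFaceSum m x = x * (oneFaceSum m (x + 1) - oneFaceSum m (x - 1)) := by
  cases m with
  | zero =>
    simp [oneFaceSum, stepDiff]
    ring
  | succ m =>
    have d (y : ℤ) : stepDiff (m + 1) (m + 1) y =
      stepDiff (m + 1) m y - stepDiff (m + 1) m (y - 2) := rfl
    have h1 := mul_stepDiff_succ (m + 1) m x
    have h2 := mul_stepDiff_succ (m + 1) m (x - 1)
    have h3 := mul_stepDiff_succ (m + 1) m (x - 2)
    have d0 := d x
    have d1 := d (x - 1)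
    have d2 := d (x - 2)
    rw [oneFaceSum_succ, oneFaceSum_succ, oneFaceSum_succ]
    push_cast at h1 h2 h3 ⊢
    ring_nf at h1 h2 h3 d0 d1 d2 ⊢
    linear_combination -h1 - 2 * h2 - h3 + x * d0 + 2 * (x - 1) * d1 + (x - 2) * d2

/-! ### Evaluation of the vertex-counting sum -/

theorem sum_isCycleOn_invariantColorings {ι : Type*} [Fintype ι] [DecidableEq ι] (m : ℕ)
    (hm : Fintype.card ι = m + 1) (N : ℕ) [NeZero N]
    [DecidablePred fun γ : Perm (ι × Bool) => γ.IsCycleOn Set.univ] :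
    ∑ γ : Perm (ι × Bool) with γ.IsCycleOn Set.univ,
      (invariantColorings (Fin N) ((edgeFlip Finset.univ)⁻¹ * γ) : ℤ) = oneFaceSum m N := by
  obtain ⟨i₀⟩ : Nonempty ι := Fintype.card_pos_iff.1 (by omega)
  have hN : (N : ℤ) ≠ 0 := by exact_mod_cast NeZero.ne N
  let r : ι × Bool := (i₀, false)
  let W : Finset (ι × Bool) → ℤ := fun S => ∑ γ : Perm (ι × Bool), signOn S γ *
        invariantColorings (Fin N) ((edgeFlip Finset.univ)⁻¹ * γ)
  have e1 : ∑ γ : Perm (ι × Bool) with γ.IsCycleOn Set.univ,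
      (invariantColorings (Fin N) ((edgeFlip Finset.univ)⁻¹ * γ) : ℤ) =
      ∑ S ∈ (Finset.univ.erase r).powerset, (-1) ^ S.card * W S := by
    rw [Finset.sum_filter]
    simp only [W, Finset.mul_sum]
    rw [Finset.sum_comm]
    refine Finset.sum_congr rfl fun γ _ => ?_
    have := sum_neg_one_pow_card_mul_signOn r γ
    simp only [← mul_assoc, ← Finset.sum_mul, this]
    split_ifs <;> simp
  have hW0 : ∀ S x y, x ≠ y → x ∈ unpaired S → y ∈ unpaired S → (-1) ^ S.card * W S = 0 := by
    intro S x y hxy hx hy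
    rw [mem_unpaired] at hx hy
    have := sum_signOn_eq_zero (α := edgeFlip Finset.univ) hxy hx.1 hy.1
      (by rw [edgeFlip_univ]; exact hx.2) (by rw [edgeFlip_univ]; exact hy.2) (Fin N)
    simp only [W, this, mul_zero]
  -- `T` misses an edge, so the rising factorial is nonempty and the natural subtractions below are
  -- exact.
  have hlt : ∀ {T : Finset ι} {i : ι}, i ∉ T → T.card ≤ m := fun {T i} h => by
    have := Finset.card_lt_univ_of_notMem h
    omega
  have hW1 : ∀ T ∈ (Finset.univ.erase r.1).powerset,
      (-1) ^ (T ×ˢ (Finset.univ : Finset Bool)).card * W (T ×ˢ Finset.univ) =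
        N * ((-1) ^ T.card * ∏ i ∈ Finset.range (2 * m + 1), ((N : ℤ) - 2 * T.card + 1 + i)) := by
    intro T hT
    have hr : r.1 ∉ T := fun h => Finset.notMem_erase _ _ (Finset.mem_powerset.1 hT h)
    have := hlt hr
    have hp := prod_sub_mul_prod_add N (2 * T.card) (2 * (m + 1) - 2 * T.card - 1)
    rw [show 2 * (m + 1) - 2 * T.card - 1 + 1 = 2 * (m + 1) - 2 * T.card by omega,
      show 2 * T.card + (2 * (m + 1) - 2 * T.card - 1) = 2 * m + 1 by omega] at hp
    simp only [W]
    rw [sum_signOn_product, hm, hp, card_product_bool, pow_mul]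
    push_cast
    ring
  have hW2 : ∀ x ∈ Finset.univ.erase r, ∀ T ∈ ((Finset.univ.erase r.1).erase x.1).powerset,
      (-1) ^ (insert x (T ×ˢ (Finset.univ : Finset Bool))).card *
        W (insert x (T ×ˢ Finset.univ)) =
        -((-1) ^ T.card *
          ∏ i ∈ Finset.range (2 * m + 1), ((N : ℤ) - 1 - 2 * T.card + 1 + i)) := by
    intro x _ T hT
    have hx : x.1 ∉ T := fun h => Finset.notMem_erase _ _ (Finset.mem_powerset.1 hT h)
    have := hlt hx
    have hp := prod_sub_mul_prod_add N (2 * T.card + 1) (2 * (m + 1) - (2 * T.card + 1) - 1)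
    rw [show 2 * (m + 1) - (2 * T.card + 1) - 1 + 1 = 2 * (m + 1) - (2 * T.card + 1) by omega,
      show 2 * T.card + 1 + (2 * (m + 1) - (2 * T.card + 1) - 1) = 2 * m + 1 by omega] at hp
    have h := mul_sum_signOn_insert_product hx N
    rw [hm, hp] at h
    have h' : W (insert x (T ×ˢ Finset.univ)) = (-1) ^ T.card *
          ∏ i ∈ Finset.range (2 * m + 1), ((N : ℤ) - 1 - 2 * T.card + 1 + i) := by
      refine mul_left_cancel₀ hN (h.trans ?_)
      push_cast
      rw [show (N : ℤ) - (2 * T.card + 1) = N - 1 - 2 * T.card by ring]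
      ring
    rw [card_insert_product_bool hx, h', pow_succ, pow_mul]
    ring
  rw [e1, sum_powerset_eq_of_two_unpaired r _ hW0, Finset.sum_congr rfl hW1, ← Finset.mul_sum,
    sum_powerset_prod_eq_stepDiff]
  -- If `x` is the partner of `r`, all `m` other edges are free for `T`; for each of the `2m`
  -- half-edges on other edges, only `m - 1` are.
  have e2 : ∀ x ∈ Finset.univ.erase r, ∑ T ∈ ((Finset.univ.erase r.1).erase x.1).powerset,
      (-1) ^ (insert x (T ×ˢ (Finset.univ : Finset Bool))).card *
        W (insert x (T ×ˢ Finset.univ)) =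
      -(if x.1 = i₀ then stepDiff m m (N - 1) else stepDiff m (m - 1) (N - 1)) := by
    intro x hx
    rw [Finset.sum_congr rfl (hW2 x hx), Finset.sum_neg_distrib, sum_powerset_prod_eq_stepDiff]
    split_ifs with h
    · rw [h, Finset.erase_eq_of_notMem (by simp [r]), Finset.card_erase_of_mem (Finset.mem_univ _),
        Finset.card_univ, hm, Nat.add_sub_cancel]
    · rw [Finset.card_erase_of_mem (by simpa [r] using h),
        Finset.card_erase_of_mem (Finset.mem_univ _), Finset.card_univ, hm, Nat.add_sub_cancel]
  rw [Finset.sum_congr rfl e2, Finset.sum_neg_distrib, Finset.card_erase_of_mem (Finset.mem_univ _),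
    Finset.card_univ, hm, Nat.add_sub_cancel, Finset.sum_erase_eq_sub (Finset.mem_univ _),
    Fintype.sum_prod_type]
  simp only [Fintype.sum_bool, r, if_true, oneFaceSum]
  rw [← Finset.add_sum_erase _ _ (Finset.mem_univ i₀)]
  rw [Finset.sum_congr rfl (g := fun _ => 2 * stepDiff m (m - 1) (N - 1))]
  · rw [Finset.sum_const, Finset.card_erase_of_mem (Finset.mem_univ _), Finset.card_univ, hm]
    simp
    ring
  · intro i hi
    rw [if_neg (Finset.ne_of_mem_erase hi)]
    ring

/-! ### Comparison of coefficients -/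

section Coefficients

open Polynomial

/-- Extraction of coefficients from `2 (n + 1) P(x) = x (P(x + 1) - P(x - 1))`. -/
theorem coeff_relation_of_difference_relation (n M v L : ℕ) (h : ℕ → ℤ) (P : ℤ → ℤ)
    (hM : ∀ w, M ≤ w → h w = 0) (hP : ∀ N : ℕ, 1 ≤ N → P N = ∑ w ∈ Finset.range M, h w * N ^ w)
    (hrel : ∀ x : ℤ, 2 * (n + 1) * P x = x * (P (x + 1) - P (x - 1))) (hv : 1 ≤ v)
    (hL : M ≤ v + 2 * L) :
    (n + 1 - v : ℤ) * h v =
      ∑ k ∈ Finset.Icc 1 L, ((v + 2 * k).choose (2 * k + 1) : ℤ) * h (v + 2 * k) := by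
  let p : ℤ[X] := ∑ w ∈ Finset.range M, monomial w (h w)
  have hcoeff : ∀ w, p.coeff w = h w := by
    intro w
    simp only [p, finsetSum_coeff, coeff_monomial, Finset.sum_ite_eq', Finset.mem_range]
    split_ifs with hw
    · rfl
    · exact (hM w (not_lt.1 hw)).symm
  have hev : ∀ N : ℕ, 1 ≤ N → p.eval (N : ℤ) = P N := by
    intro N hN
    rw [hP N hN]
    simp [p, eval_finsetSum]
  have hpoly : C (2 * (n + 1) : ℤ) * p = X * (taylor 1 p - taylor (-1) p) := by
    -- Evaluation at `N + 2` keeps all three arguments at least `1`, where `P` is given by its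
    -- coefficients.
    refine eq_of_infinite_eval_eq _ _ (Set.infinite_of_injective_forall_mem
      (f := fun N : ℕ => ((N + 2 : ℕ) : ℤ)) (fun a b hab => by simpa using hab) fun N => ?_)
    have h1 := hev (N + 2) (by omega)
    have h2 := hev (N + 3) (by omega)
    have h3 := hev (N + 1) (by omega)
    have hr := hrel (N + 2 : ℕ)
    rw [show (((N + 2 : ℕ) : ℤ) + 1) = ((N + 3 : ℕ) : ℤ) by push_cast; ring,
      show (((N + 2 : ℕ) : ℤ) - 1) = ((N + 1 : ℕ) : ℤ) by push_cast; ring, ← h1, ← h2, ← h3] at hr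
    simp only [Set.mem_ofPred_eq, eval_mul, eval_C, eval_X, eval_sub, taylor_eval]
    rw [hr, show (((N + 2 : ℕ) : ℤ) + 1) = ((N + 3 : ℕ) : ℤ) by push_cast; ring,
      show (((N + 2 : ℕ) : ℤ) + -1) = ((N + 1 : ℕ) : ℤ) by push_cast; ring]
  obtain ⟨u, rfl⟩ : ∃ u, v = u + 1 := ⟨v - 1, by omega⟩
  have htay : ∀ r : ℤ, (taylor r p).coeff u =
      ∑ w ∈ Finset.range M, (w.choose u : ℤ) * h w * r ^ (w - u) := by
    intro r
    rw [taylor_coeff]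
    simp only [p, map_sum, eval_finsetSum, hasseDeriv_monomial, eval_monomial]
  have hc := congrArg (fun q : ℤ[X] => q.coeff (u + 1)) hpoly
  simp only [coeff_C_mul, coeff_X_mul, coeff_sub, htay, hcoeff, ← Finset.sum_sub_distrib,
    one_pow] at hc
  have hsum : ∑ w ∈ Finset.range M, ((w.choose u : ℤ) * h w * 1 -
      (w.choose u : ℤ) * h w * (-1) ^ (w - u)) = ∑ k ∈ Finset.range (L + 1),
        2 * (((u + 1 + 2 * k).choose (2 * k + 1) : ℤ) * h (u + 1 + 2 * k)) := by
    have hext : ∑ w ∈ Finset.range M, ((w.choose u : ℤ) * h w * 1 -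
        (w.choose u : ℤ) * h w * (-1) ^ (w - u)) = ∑ w ∈ Finset.range (u + 1 + 2 * L + 1),
          ((w.choose u : ℤ) * h w * 1 - (w.choose u : ℤ) * h w * (-1) ^ (w - u)) := by
      refine Finset.sum_subset (Finset.range_subset_range.2 (by omega)) fun w _ hw => ?_
      rw [hM w (by simpa using hw)]
      ring
    rw [hext]
    symm
    -- Terms with `w - u` even cancel and those with `w - u` odd double; `w < u` gives a zero
    -- binomial.
    refine Finset.sum_of_injOn (fun k => u + 1 + 2 * k) (fun a _ b _ hab => ?_) (fun k hk => ?_)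
      (fun w hw hw' => ?_) (fun k _ => ?_)
    · simp only at hab
      omega
    · simp only [Finset.coe_range, Set.mem_Iio] at hk ⊢
      omega
    · rcases lt_or_ge w u with hwu | hwu
      · rw [Nat.choose_eq_zero_of_lt hwu]
        simp
      rcases Nat.even_or_odd (w - u) with he | ⟨k, hk⟩
      · rw [he.neg_one_pow]
        ring
      · refine absurd ⟨k, ?_, ?_⟩ hw'
        · simp only [Finset.coe_range, Set.mem_Iio, Finset.mem_range] at hw ⊢
          omega
        · simp only
          omega
    · rw [show u + 1 + 2 * k - u = 2 * k + 1 by omega, pow_succ, pow_mul,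
        Nat.choose_symm_of_eq_add (show u + 1 + 2 * k = u + (2 * k + 1) by ring)]
      ring
  have hIcc : (Finset.range L).image (fun k => k + 1) = Finset.Icc 1 L := by
    ext k
    simp only [Finset.mem_image, Finset.mem_range, Finset.mem_Icc]
    exact ⟨fun ⟨a, ha, hak⟩ => by omega, fun hk => ⟨k - 1, by omega, by omega⟩⟩
  rw [hsum, Finset.sum_range_succ', ← Finset.mul_sum] at hc
  simp only [mul_zero, add_zero, zero_add, Nat.choose_one_right] at hc
  rw [← Finset.sum_image (s := Finset.range L) (g := fun k => k + 1) (by simp)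
    (f := fun k => ((u + 1 + 2 * k).choose (2 * k + 1) : ℤ) * h (u + 1 + 2 * k)),
    hIcc] at hc
  linarith

/-- Descending induction on `v`: the right side of the coefficient relation involves only larger
indices, and `n + 1 - v` is nonzero. This yields the bound of `n + 1` vertices without topology. -/
theorem eq_zero_of_difference_relation (n M : ℕ) (h : ℕ → ℤ) (P : ℤ → ℤ)
    (hM : ∀ w, M ≤ w → h w = 0) (hP : ∀ N : ℕ, 1 ≤ N → P N = ∑ w ∈ Finset.range M, h w * N ^ w)
    (hrel : ∀ x : ℤ, 2 * (n + 1) * P x = x * (P (x + 1) - P (x - 1))) (v : ℕ) (hv : n + 1 < v) :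
    h v = 0 := by
  induction hd : M - v using Nat.strong_induction_on generalizing v with
  | _ d ih =>
    by_cases hMv : M ≤ v
    · exact hM v hMv
    have key := coeff_relation_of_difference_relation n M v M h P hM hP hrel (by omega) (by omega)
    rw [Finset.sum_eq_zero] at key
    · exact (mul_eq_zero.1 key).resolve_left (by omega)
    · intro k hk
      have := (Finset.mem_Icc.1 hk).1
      rw [ih (M - (v + 2 * k)) (by omega) (v + 2 * k) (by omega) rfl, mul_zero]

end Coefficients

/-! ### Transport along relabellings and maps with fixed edges -/

section Transport

variable {X Y : Type*}

theorem permCongr_zpow_apply (e : X ≃ Y) (ρ : Perm X) (k : ℤ) (x : X) :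
    (e.permCongr ρ ^ k) (e x) = e ((ρ ^ k) x) := by
  have := congrArg (fun τ : Perm Y => τ (e x)) (map_zpow e.permCongrHom ρ k)
  simpa using this.symm

theorem sameCycle_permCongr (e : X ≃ Y) (ρ : Perm X) (x y : X) :
    (e.permCongr ρ).SameCycle (e x) (e y) ↔ ρ.SameCycle x y := by
  simp only [Perm.SameCycle, permCongr_zpow_apply, e.injective.eq_iff]

theorem isCycleOn_univ_iff {ρ : Perm X} :
    ρ.IsCycleOn Set.univ ↔ ∀ x y, ρ.SameCycle x y :=
  ⟨fun h x y => h.2 (Set.mem_univ x) (Set.mem_univ y), fun h => ⟨by simpa using ρ.bijective, fun x _ y _ => h x y⟩⟩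

theorem isCycleOn_univ_permCongr (e : X ≃ Y) (ρ : Perm X) :
    (e.permCongr ρ).IsCycleOn Set.univ ↔ ρ.IsCycleOn Set.univ := by
  simp only [isCycleOn_univ_iff]
  rw [e.symm.forall_congr_left]
  simp [e.symm.forall_congr_left, sameCycle_permCongr]

/-- The number of cycles of `ρ`, fixed points included. -/
noncomputable def numCycles (ρ : Perm X) : ℕ :=
  Nat.card (Quotient (Perm.SameCycle.setoid ρ))

theorem numCycles_permCongr (e : X ≃ Y) (ρ : Perm X) : numCycles (e.permCongr ρ) = numCycles ρ :=
  (Nat.card_congr (Quotient.congr e fun x y => (sameCycle_permCongr e ρ x y).symm)).symm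

/-- Both have cycle type consisting of `|X| / 2` twos. -/
theorem isConj_of_fixedPointFree_involutions [Finite X] {σ τ : Perm X}
    (hσ : ∀ x, σ (σ x) = x) (hσ' : ∀ x, σ x ≠ x) (hτ : ∀ x, τ (τ x) = x) (hτ' : ∀ x, τ x ≠ x) :
    IsConj σ τ := by
  classical
  have := Fintype.ofFinite X
  have key : ∀ ρ : Perm X, (∀ x, ρ (ρ x) = x) → (∀ x, ρ x ≠ x) →
      ρ.cycleType = Multiset.replicate (Fintype.card X / 2) 2 := by
    intro ρ h h'
    have h2 : ρ ^ 2 = 1 := Perm.ext fun x => by rw [pow_two, Perm.mul_apply, h, Perm.one_apply]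
    have hr := Perm.cycleType_of_pow_prime_eq_one (p := 2) h2
    have hs := Perm.sum_cycleType ρ
    have hu : ρ.support = Finset.univ := Finset.eq_univ_iff_forall.2 fun x => by simpa using h' x
    rw [hr, Multiset.sum_replicate, hu, Finset.card_univ, smul_eq_mul] at hs
    rw [hr, ← hs, Nat.mul_div_cancel _ two_pos]
  rw [Perm.isConj_iff_cycleType_eq, key σ hσ hσ', key τ hτ hτ']

end Transport

/-- The number of one-face maps with `v` vertices on the half-edges `Fin n × Bool` whose edges
are given by `edgeFlip`. -/
noncomputable def gluingCount (n v : ℕ) : ℕ :=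
  Nat.card {γ : Perm (Fin n × Bool) // γ.IsCycleOn Set.univ ∧
    numCycles ((edgeFlip Finset.univ)⁻¹ * γ) = v}

theorem gluingCount_eq_zero {n v : ℕ} (hv : 2 * n + 1 ≤ v) : gluingCount n v = 0 := by
  rw [gluingCount, Nat.card_eq_zero]
  left
  refine ⟨fun γ => ?_⟩
  have h1 := γ.2.2
  have h2 : numCycles ((edgeFlip Finset.univ)⁻¹ * γ.1) ≤ Nat.card (Fin n × Bool) :=
    Nat.card_le_card_of_surjective _ Quotient.mk_surjective
  rw [h1, Nat.card_prod, Nat.card_fin, Nat.card_eq_fintype_card, Fintype.card_bool] at h2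
  omega

theorem oneFaceSum_eq_sum_gluingCount (m N : ℕ) (hN : 1 ≤ N) :
    oneFaceSum m N =
      ∑ v ∈ Finset.range (2 * (m + 1) + 1), (gluingCount (m + 1) v : ℤ) * N ^ v := by
  classical
  have : NeZero N := ⟨by omega⟩
  rw [← sum_isCycleOn_invariantColorings (ι := Fin (m + 1)) m (by simp)]
  simp only [invariantColorings_eq_pow, Nat.card_fin]
  have hmaps : ∀ γ ∈ Finset.univ.filter (fun γ : Perm (Fin (m + 1) × Bool) =>
      γ.IsCycleOn Set.univ), numCycles ((edgeFlip Finset.univ)⁻¹ * γ) ∈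
        Finset.range (2 * (m + 1) + 1) := by
    intro γ hγ
    by_contra h
    have h0 := gluingCount_eq_zero (by simpa using h :
      2 * (m + 1) + 1 ≤ numCycles ((edgeFlip Finset.univ)⁻¹ * γ))
    rw [gluingCount, Nat.card_eq_zero] at h0
    rcases h0 with h0 | h0
    · exact h0.false ⟨γ, (Finset.mem_filter.1 hγ).2, rfl⟩
    · exact absurd h0 (not_infinite_iff_finite.2 inferInstance)
  rw [← Finset.sum_fiberwise_of_maps_to hmaps]
  refine Finset.sum_congr rfl fun v _ => ?_
  rw [Finset.sum_congr rfl (g := fun _ => (N : ℤ) ^ v), Finset.sum_const, nsmul_eq_mul,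
    gluingCount, Nat.card_eq_fintype_card, Fintype.card_subtype, Finset.filter_filter]
  intro γ hγ
  have := (Finset.mem_filter.1 hγ).2
  rw [numCycles] at this
  push_cast
  rw [this]

theorem gluingCount_relation (m v g : ℕ) (hv : 1 ≤ v) (hg : v + 2 * g = m + 2) :
    2 * (g : ℤ) * gluingCount (m + 1) v =
      ∑ k ∈ Finset.Icc 1 g,
        ((v + 2 * k).choose (2 * k + 1) : ℤ) * gluingCount (m + 1) (v + 2 * k) := by
  have hM : ∀ w, 2 * (m + 1) + 1 ≤ w → (gluingCount (m + 1) w : ℤ) = 0 := fun w hw => by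
    rw [gluingCount_eq_zero hw, Nat.cast_zero]
  have hrel : ∀ x : ℤ, 2 * ((m + 1 : ℕ) + 1) * oneFaceSum m x =
      x * (oneFaceSum m (x + 1) - oneFaceSum m (x - 1)) := fun x => by
    rw [← oneFaceSum_relation]
    push_cast
    ring
  have h1 := coeff_relation_of_difference_relation (m + 1) _ v (g + (2 * (m + 1) + 1)) _ _ hM
    (oneFaceSum_eq_sum_gluingCount m) hrel hv (by omega)
  have h2 := eq_zero_of_difference_relation (m + 1) _ _ _ hM
    (oneFaceSum_eq_sum_gluingCount m) hrel
  rw [← Finset.sum_subset (Finset.Icc_subset_Icc_right (Nat.le_add_right g _))] at h1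
  · rw [← h1]
    congr 1
    push_cast
    have : (v : ℤ) + 2 * g = m + 2 := by exact_mod_cast hg
    linarith
  · intro k hk hk'
    rw [Finset.mem_Icc] at hk hk'
    rw [h2 (v + 2 * k) (by omega), mul_zero]

/-! ### From equivalence classes to labelled maps -/

namespace RootedOneFaceMap

variable {n : ℕ}

/-- Relabelling the half-edges of a map. -/
def relabel (π : Perm (Fin (2 * n))) (M : RootedOneFaceMap n) : RootedOneFaceMap n where
  α := π * M.α * π⁻¹
  β := π * M.β * π⁻¹
  γ := π * M.γ * π⁻¹
  involutive i := by simp [M.involutive]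
  fixedPointFree i h := M.fixedPointFree (π⁻¹ i) (by
    simpa using congrArg (π⁻¹ : Perm (Fin (2 * n))) h)
  γ_eq := by
    rw [M.γ_eq]
    group
  oneFace := (isCycleOn_univ_permCongr π M.γ).2 M.oneFace

theorem β_eq (M : RootedOneFaceMap n) : M.β = M.α⁻¹ * M.γ := by
  rw [M.γ_eq, inv_mul_cancel_left]

theorem eq_relabel {M M' : RootedOneFaceMap n} {π : Perm (Fin (2 * n))}
    (hα : M'.α = π * M.α * π⁻¹) (hγ : M'.γ = π * M.γ * π⁻¹) : M' = M.relabel π := by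
  refine RootedOneFaceMap.ext hα ?_ hγ
  rw [β_eq, hα, hγ]
  change _ = π * M.β * π⁻¹
  rw [β_eq]
  group

theorem hasGenus_relabel (π : Perm (Fin (2 * n))) (M : RootedOneFaceMap n) (g : ℕ) :
    (M.relabel π).HasGenus g ↔ M.HasGenus g := by
  unfold HasGenus numVertices
  have : Nat.card (Quotient (Perm.SameCycle.setoid (M.relabel π).β)) =
      Nat.card (Quotient (Perm.SameCycle.setoid M.β)) := numCycles_permCongr π M.β
  rw [this]

/-- `π'⁻¹π` fixes the root and commutes with the transitive `γ`, so it is the identity. -/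
theorem relabel_injective (hn : n ≠ 0) (M : RootedOneFaceMap n) {π π' : Perm (Fin (2 * n))}
    (hπ : ∀ i, i.val = 0 → π i = i) (hπ' : ∀ i, i.val = 0 → π' i = i)
    (h : M.relabel π = M.relabel π') : π = π' := by
  let r : Fin (2 * n) := ⟨0, by omega⟩
  have hγ : (π'⁻¹ * π) * M.γ = M.γ * (π'⁻¹ * π) := by
    have : π * M.γ * π⁻¹ = π' * M.γ * π'⁻¹ := congrArg RootedOneFaceMap.γ h
    calc (π'⁻¹ * π) * M.γ = π'⁻¹ * (π * M.γ * π⁻¹) * π := by group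
      _ = M.γ * (π'⁻¹ * π) := by rw [this]; group
  have hr : (π'⁻¹ * π) r = r := by
    rw [Perm.mul_apply, hπ r rfl, Perm.inv_eq_iff_eq, hπ' r rfl]
  have : π'⁻¹ * π = 1 := by
    ext1 x
    obtain ⟨k, rfl⟩ := isCycleOn_univ_iff.1 M.oneFace r x
    have hc : Commute (π'⁻¹ * π) (M.γ ^ k) := Commute.zpow_right hγ k
    rw [← Perm.mul_apply, hc.eq, Perm.mul_apply, hr, Perm.one_apply]
  exact (inv_mul_eq_one.1 this).symm

/-- The root-fixing relabellings act freely, and their orbits are the equivalence classes. -/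
theorem card_eq_oneFaceMapCount_mul (hn : n ≠ 0) (g : ℕ) :
    Nat.card {M : RootedOneFaceMap n // M.HasGenus g} =
      oneFaceMapCount n g *
        Nat.card {π : Perm (Fin (2 * n)) // ∀ i, i.val = 0 → π i = i} := by
  rw [oneFaceMapCount, ← Nat.card_prod]
  symm
  refine Nat.card_congr (Equiv.ofBijective
    (fun p => ⟨p.1.out.1.relabel p.2.1, (hasGenus_relabel _ _ _).2 p.1.out.2⟩) ⟨?_, ?_⟩)
  · rintro ⟨q, π, hπ⟩ ⟨q', π', hπ'⟩ h
    have h : q.out.1.relabel π = q'.out.1.relabel π' := congrArg Subtype.val h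
    have hq : q = q' := by
      rw [← q.out_eq, ← q'.out_eq]
      refine Quotient.sound ((equivSetoid n).trans (b := q.out.1.relabel π)
        ⟨π, rfl, rfl, hπ⟩ ?_)
      rw [h]
      exact (equivSetoid n).symm ⟨π', rfl, rfl, hπ'⟩
    subst hq
    have := relabel_injective hn _ hπ hπ' h
    subst this
    rfl
  · rintro ⟨M, hM⟩
    let q := Quotient.mk ((equivSetoid n).comap
      (Subtype.val : {M : RootedOneFaceMap n // M.HasGenus g} → RootedOneFaceMap n)) ⟨M, hM⟩
    obtain ⟨π, hα, hγ, hπ⟩ : Equivalent q.out.1 M := Quotient.mk_out (s := (equivSetoid n).comap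
      (Subtype.val : {M : RootedOneFaceMap n // M.HasGenus g} → RootedOneFaceMap n)) ⟨M, hM⟩
    exact ⟨(q, ⟨π, hπ⟩), Subtype.ext (eq_relabel hα hγ).symm⟩

theorem hasGenus_iff (hn : n ≠ 0) (M : RootedOneFaceMap n) (g : ℕ) :
    M.HasGenus g ↔ (numCycles M.β : ℤ) = n + 1 - 2 * g := by
  rw [HasGenus, numVertices, if_neg hn, numCycles]
  constructor <;> intro h <;> linarith

theorem exists_permCongr_eq_edgeFlip {α : Perm (Fin (2 * n))} (hα : ∀ i, α (α i) = i)
    (hα' : ∀ i, α i ≠ i) :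
    ∃ e : Fin (2 * n) ≃ Fin n × Bool, e.permCongr α = edgeFlip Finset.univ := by
  let e₀ : Fin (2 * n) ≃ Fin n × Bool := Fintype.equivOfCardEq (by simp [mul_comm])
  obtain ⟨c, hc⟩ := isConj_iff.1 (isConj_of_fixedPointFree_involutions (σ := e₀.permCongr α)
    (τ := edgeFlip (Finset.univ : Finset (Fin n))) (fun x => by simp [hα])
    (fun x h => hα' (e₀.symm x) (by simpa using congrArg e₀.symm h))
    (fun x => by simp [edgeFlip_univ])
    (fun x h => by simpa [edgeFlip_univ] using congrArg Prod.snd h))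
  refine ⟨e₀.trans c, ?_⟩
  rw [← hc]
  ext1 x
  simp

theorem card_eq_mul_gluingCount (hn : n ≠ 0) (g v : ℕ) (hv : (v : ℤ) = n + 1 - 2 * g) :
    Nat.card {M : RootedOneFaceMap n // M.HasGenus g} =
      Nat.card {α : Perm (Fin (2 * n)) // (∀ i, α (α i) = i) ∧ ∀ i, α i ≠ i} *
        gluingCount n v := by
  -- One relabelling per involution, carrying it to the standard flip; transporting `γ` along it
  -- identifies all fibres over `α`.
  choose e he using fun α : {α : Perm (Fin (2 * n)) // (∀ i, α (α i) = i) ∧ ∀ i, α i ≠ i} =>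
    exists_permCongr_eq_edgeFlip α.2.1 α.2.2
  have hcong : ∀ α γ, numCycles ((edgeFlip Finset.univ)⁻¹ * (e α).permCongr γ) =
      numCycles (α.1⁻¹ * γ) := by
    intro α γ
    rw [← he α, ← numCycles_permCongr (e α) (α.1⁻¹ * γ)]
    exact congrArg numCycles (by
      have := map_mul (e α).permCongrHom α.1⁻¹ γ
      rw [map_inv] at this
      exact this.symm)
  rw [gluingCount, ← Nat.card_prod]
  refine Nat.card_congr ⟨fun M => (⟨M.1.α, M.1.involutive, M.1.fixedPointFree⟩,
      ⟨(e ⟨M.1.α, M.1.involutive, M.1.fixedPointFree⟩).permCongr M.1.γ,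
        (isCycleOn_univ_permCongr _ _).2 M.1.oneFace, ?_⟩),
    fun p => ⟨⟨p.1.1, p.1.1⁻¹ * (e p.1).permCongr.symm p.2.1, (e p.1).permCongr.symm p.2.1,
      p.1.2.1, p.1.2.2, (mul_inv_cancel_left _ _).symm, ?_⟩, ?_⟩, ?_, ?_⟩
  · rw [hcong, ← β_eq]
    have := (hasGenus_iff hn M.1 g).1 M.2
    rw [← hv] at this
    exact_mod_cast this
  · rw [← isCycleOn_univ_permCongr (e p.1), Equiv.apply_symm_apply]
    exact p.2.2.1
  · rw [hasGenus_iff hn, ← hv]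
    simp only
    rw [← hcong, Equiv.apply_symm_apply, p.2.2.2]
  · rintro ⟨M, hM⟩
    refine Subtype.ext (RootedOneFaceMap.ext rfl ?_ ?_)
    · rw [β_eq M]
      simp only [Equiv.symm_apply_apply]
    · simp only [Equiv.symm_apply_apply]
  · rintro ⟨α, γ, hγ⟩
    simp only [Equiv.apply_symm_apply]

theorem oneFaceMapCount_mul (hn : n ≠ 0) (g v : ℕ) (hv : (v : ℤ) = n + 1 - 2 * g) :
    oneFaceMapCount n g * Nat.card {π : Perm (Fin (2 * n)) // ∀ i, i.val = 0 → π i = i} =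
      Nat.card {α : Perm (Fin (2 * n)) // (∀ i, α (α i) = i) ∧ ∀ i, α i ≠ i} *
        gluingCount n v := by
  rw [← card_eq_oneFaceMapCount_mul hn, card_eq_mul_gluingCount hn g v hv]

theorem oneFaceMapCount_eq_zero (g : ℕ) (h : ∀ M : RootedOneFaceMap n, ¬ M.HasGenus g) :
    oneFaceMapCount n g = 0 := by
  rw [oneFaceMapCount, Nat.card_eq_zero]
  left
  refine ⟨fun q => ?_⟩
  exact h q.out.1 q.out.2

theorem oneFaceMapCount_of_nonpos (hn : n ≠ 0) (g : ℕ) (h : (n : ℤ) + 1 - 2 * g ≤ 0) :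
    oneFaceMapCount n g = 0 := by
  refine oneFaceMapCount_eq_zero g fun M hM => ?_
  rw [hasGenus_iff hn] at hM
  have h0 : numCycles M.β = 0 := by omega
  rw [numCycles, Nat.card_eq_zero] at h0
  rcases h0 with h | h
  · exact h.false ⟦⟨0, by omega⟩⟧
  · exact absurd h (not_infinite_iff_finite.2 inferInstance)

theorem oneFaceMapCount_zero_left (g : ℕ) (hg : g ≠ 0) : oneFaceMapCount 0 g = 0 := by
  refine oneFaceMapCount_eq_zero g fun M hM => hg ?_
  rw [HasGenus, numVertices, if_pos rfl] at hM
  push_cast at hM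
  omega

end RootedOneFaceMap

/-! ### Degenerate cases and conclusion -/

open RootedOneFaceMap

theorem mainTheorem4 (n g : ℕ) :
    2 * (g : ℤ) * (oneFaceMapCount n g : ℤ) =
      ∑ k ∈ Finset.Icc 1 g,
        Ring.choose ((n : ℤ) + 1 - 2 * ((g : ℤ) - (k : ℤ))) (2 * k + 1) *
          (oneFaceMapCount n (g - k) : ℤ) := by
  rcases Nat.eq_zero_or_pos n with rfl | hn
  · rw [Finset.sum_eq_zero]
    · rcases Nat.eq_zero_or_pos g with rfl | hg
      · simp
      · rw [oneFaceMapCount_zero_left g hg.ne']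
        simp
    · intro k hk
      rw [Finset.mem_Icc] at hk
      rcases Nat.eq_zero_or_pos (g - k) with h | h
      · obtain rfl : g = k := by omega
        rw [show ((0 : ℕ) : ℤ) + 1 - 2 * ((g : ℤ) - g) = ((1 : ℕ) : ℤ) by push_cast; ring,
          Ring.choose_natCast, Nat.choose_eq_zero_of_lt (by omega)]
        simp
      · rw [oneFaceMapCount_zero_left _ h.ne']
        simp
  -- No vertices would remain, so the left side vanishes. On the right, either the count is zero or
  -- the upper index lies in `1, …, 2k`, killing the binomial.
  · rcases le_or_gt ((n : ℤ) + 1 - 2 * g) 0 with h | h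
    · rw [oneFaceMapCount_of_nonpos hn.ne' g h, Finset.sum_eq_zero]
      · simp
      · intro k hk
        rw [Finset.mem_Icc] at hk
        rcases le_or_gt ((n : ℤ) + 1 - 2 * ((g : ℤ) - k)) 0 with h' | h'
        · rw [oneFaceMapCount_of_nonpos hn.ne' _ (by push_cast [hk.2]; exact h')]
          simp
        · obtain ⟨w, hw⟩ := Int.eq_ofNat_of_zero_le h'.le
          rw [hw, Ring.choose_natCast, Nat.choose_eq_zero_of_lt (by omega)]
          simp
    · obtain ⟨v, hv⟩ := Int.eq_ofNat_of_zero_le h.le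
      obtain ⟨m, rfl⟩ : ∃ m, n = m + 1 := ⟨n - 1, by omega⟩
      have hrel := gluingCount_relation m v g (by omega) (by push_cast at hv; omega)
      have hc : (Nat.card {π : Perm (Fin (2 * (m + 1))) // ∀ i, i.val = 0 → π i = i} : ℤ) ≠ 0 := by
        have : Nonempty {π : Perm (Fin (2 * (m + 1))) // ∀ i, i.val = 0 → π i = i} :=
          ⟨1, fun _ _ => rfl⟩
        exact Nat.cast_ne_zero.2 Nat.card_pos.ne'
      refine mul_right_cancel₀ hc ?_
      have h1 := oneFaceMapCount_mul hn.ne' g v hv.symm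
      rw [mul_assoc, ← Nat.cast_mul, h1, Nat.cast_mul, mul_left_comm, hrel, Finset.mul_sum,
        Finset.sum_mul]
      refine Finset.sum_congr rfl fun k hk => ?_
      rw [Finset.mem_Icc] at hk
      have hw : (((v + 2 * k : ℕ) : ℤ)) = (m + 1 : ℕ) + 1 - 2 * ((g : ℤ) - k) := by
        push_cast at hv ⊢
        linarith
      have h2 := oneFaceMapCount_mul hn.ne' (g - k) (v + 2 * k) (by push_cast [hk.2] at hw ⊢; exact hw)
      rw [← hw, Ring.choose_natCast, mul_assoc, ← Nat.cast_mul (oneFaceMapCount _ _), h2,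
        Nat.cast_mul]
      ring
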